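/- Let $n\ge 2$ be an integer and let $G$ be a finite abelian group isomorphic to $C_2\oplus C_2\oplus C_{2n}$, so that $\exp(G)=2n$. A sequence over $G$ is a finite unordered sequence of elements of $G$ with repetition allowed, i.e. an element of the free abelian monoid over $G$, written multiplicatively; $\sigma(S)$ denotes the sum of the terms of $S$, $\operatorname{supp}(S)$ the set of elements occurring in $S$, and $|S|$ its length. A short zero-sum subsequence is a nonempty subsequence of length at most $\exp(G)$ with sum $0$, and $\eta(G)$ is the smallest integer $\ell\ge 0$ such that every sequence over $G$ of length at least $\ell$ has a short zero-sum subsequence. A basis of $G$ is a generating set $\{f_1,f_2,f_3\}$ that is independent, i.e. $\sum_i a_if_i=0$ with $a_i\in\mathbb Z$ implies $a_if_i=0$ for every $i$. Then $\eta(G)=2n+4$, and a sequence $S$ over $G$ of length $|S|=\eta(G)-1=2n+3$ contains no short zero-sum subsequence if and only if there exists a basis $\{f_1,f_2,f_3\}$ of $G$ with $\operatorname{ord}(f_1)=\operatorname{ord}(f_2)=2$ and $\operatorname{ord}(f_3)=2n$ such that $S$ is equal to one of the following sequences (where the parameters $v,a,b$ are integers): - $(\eta 1)$ $\; f_3^{2n-1-2v}\,(f_3+f_2)^{2v+1}\,f_2\,(af_3+f_1)\,\bigl((1-a)f_3+f_2+f_1\bigr)$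 with $0\le v\le n-1$ and $2\le a\le n-1$; - $(\eta 2)$ $\; f_3^{2n-1}\,(af_3+f_2)\,\bigl((1-a)f_3+f_2\bigr)\,(bf_3+f_1)\,\bigl((1-b)f_3+f_1\bigr)$ with $2\le b\le a\le n-1$; - $(\eta 3)$ $\; \prod_{i=1}^{2n+1}(f_3+d_i)\cdot f_2 f_1$, where $S'=\prod_{i=1}^{2n+1}d_i$ is a sequence over the subgroup $\langle f_1,f_2\rangle$ with $\sigma(S')\notin\operatorname{supp}(S')$. -/

import Mathlib

/-! Sequences over an additive abelian group `G` (elements of the free abelian monoid over `G`) are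
multisets `S : Multiset G`: the length is `S.card`, the sum is `S.sum`, subsequences are `T ≤ S`,
the product of sequences is the sum of multisets, and `g ∈ S` says that `g` lies in the support. -/

namespace ZeroSum

variable {G : Type*} [AddCommGroup G]

/-- A family is independent if `∑ aᵢ gᵢ = 0` with integers `aᵢ` implies `aᵢ gᵢ = 0` for all `i`. -/
def Independent {ι : Type*} [Fintype ι] (g : ι → G) : Prop :=
  ∀ a : ι → ℤ, ∑ i, a i • g i = 0 → ∀ i, a i • g i = 0

/-- A basis is an independent generating family. -/
def IsBasis {ι : Type*} [Fintype ι] (g : ι → G) : Prop :=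
  Independent g ∧ AddSubgroup.closure (Set.range g) = ⊤

/-- `S` has a short zero-sum subsequence: one that is nonempty, of length at most `exp(G)`, and
has sum `0`. -/
def HasShortZeroSum (S : Multiset G) : Prop :=
  ∃ T ≤ S, T ≠ 0 ∧ T.card ≤ AddMonoid.exponent G ∧ T.sum = 0

variable (G) in
/-- The constant `η(G)`: the smallest `ℓ` such that every sequence of length at least `ℓ` has a
short zero-sum subsequence. (It is `0` if there is no such `ℓ`; this does not occur for finite `G`,
and `η(G) > 0` otherwise, as the empty sequence has no nonempty subsequence.) -/
noncomputable def eta : ℕ :=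
  sInf {l : ℕ | ∀ S : Multiset G, l ≤ S.card → HasShortZeroSum S}

/-- `f₃^(2n-1-2v) (f₃+f₂)^(2v+1) f₂ (a f₃+f₁) ((1-a) f₃+f₂+f₁)` with `v ∈ [0, n-1]` and
`a ∈ [2, n-1]`. -/
def FormEta1 (n : ℕ) (f₁ f₂ f₃ : G) (S : Multiset G) : Prop :=
  ∃ (v : ℕ) (a : ℤ), v ≤ n - 1 ∧ 2 ≤ a ∧ a ≤ (n : ℤ) - 1 ∧
    S = Multiset.replicate (2 * n - 1 - 2 * v) f₃ + Multiset.replicate (2 * v + 1) (f₃ + f₂)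
      + {f₂, a • f₃ + f₁, (1 - a) • f₃ + f₂ + f₁}

/-- `f₃^(2n-1) (a f₃+f₂) ((1-a) f₃+f₂) (b f₃+f₁) ((1-b) f₃+f₁)` with `a, b ∈ [2, n-1]` and
`a ≥ b`. -/
def FormEta2 (n : ℕ) (f₁ f₂ f₃ : G) (S : Multiset G) : Prop :=
  ∃ a b : ℤ, 2 ≤ a ∧ a ≤ (n : ℤ) - 1 ∧ 2 ≤ b ∧ b ≤ (n : ℤ) - 1 ∧ b ≤ a ∧
    S = Multiset.replicate (2 * n - 1) f₃
      + {a • f₃ + f₂, (1 - a) • f₃ + f₂, b • f₃ + f₁, (1 - b) • f₃ + f₁}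

/-- `∏ (f₃ + dᵢ) f₂ f₁`, the product over `i ∈ [1, 2n+1]`, where `S' = ∏ dᵢ` is a sequence over
`⟨f₁, f₂⟩` whose sum is not in its support. -/
def FormEta3 (n : ℕ) (f₁ f₂ f₃ : G) (S : Multiset G) : Prop :=
  ∃ S' : Multiset G, S'.card = 2 * n + 1 ∧ (∀ d ∈ S', d ∈ AddSubgroup.closure {f₁, f₂}) ∧
    S'.sum ∉ S' ∧ S = S'.map (fun d => f₃ + d) + {f₂, f₁}

end ZeroSum

/-! Let `π` be reduction modulo 2, onto an elementary 2-group of order 8, with kernel of order `n`.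
A zero-sum free sequence over a group of order `n` has at most `n - 1` terms, and if it has exactly
`n - 1`, they are all equal to one generator. Call a nonempty sequence with sum in the kernel a
block. If `S` has no short zero-sum subsequence, the sums of disjoint blocks of total length at most
`2 * n` form a zero-sum free sequence over the kernel.

As there are eight classes, `n - 2` pairs with equal images can be split off, leaving at least seven
elements `W`. A block of at most four elements of `W` completes the pair sums to `n - 1` terms.
Hence all such blocks have the same sum, of order `n`, and two disjoint ones of total length at most
four cannot exist (`Peeled.block_sum_eq`, `Peeled.not_two_blocks`). The geometry of the Fano plane
then excludes the zero class and six distinct classes, so `W` is one pair plus five distinct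
classes. This bounds the length of `S` by `2 * n + 3`.

At that length the five classes lie on two lines through a common point `x`. Equality of block sums
lifts this to `a + b = c + d = x` in `G`, and exchanging pairs shows that every pair is some `{s,
s}` with `2s = 2x` (`exists_shape`). Since `2a + 2b = 2c + 2d = 2x`, the forms (η3), (η1), (η2)
arise according to whether two, one or none of `{a, b}`, `{c, d}` contain an element with double
`2x`.

Conversely, in a basis a zero sum gives parity conditions at `f₁, f₂` and divisibility by `2 * n` at
`f₃`, and these force a length above `2 * n` or contradict the form. -/

namespace ZeroSum

variable {G : Type*} [AddCommGroup G]

/-! ### Zero-sum free sequences of maximal length -/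

/-- No nonempty subsequence has sum zero. -/
def ZeroSumFree (U : Multiset G) : Prop := ∀ T ≤ U, T ≠ 0 → T.sum ≠ 0

theorem ZeroSumFree.mono {U U' : Multiset G} (h : ZeroSumFree U) (hle : U' ≤ U) :
    ZeroSumFree U' := fun T hT => h T (hT.trans hle)

/-- The set of sums of subsequences, the empty one included. -/
def subsums (U : Multiset G) : Set G := {s | ∃ T ≤ U, T.sum = s}

theorem zero_mem_subsums (U : Multiset G) : (0 : G) ∈ subsums U := ⟨0, Multiset.zero_le _, by simp⟩

theorem subsums_finite (U : Multiset G) : (subsums U).Finite := by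
  classical
  refine ((U.powerset.map Multiset.sum).toFinset.finite_toSet).subset ?_
  rintro s ⟨T, hT, rfl⟩
  simp only [Finset.mem_coe, Multiset.mem_toFinset, Multiset.mem_map, Multiset.mem_powerset]
  exact ⟨T, hT, rfl⟩

theorem subsums_mono {U U' : Multiset G} (h : U ≤ U') : subsums U ⊆ subsums U' := by
  rintro s ⟨T, hT, rfl⟩
  exact ⟨T, hT.trans h, rfl⟩

theorem add_mem_subsums_cons (x : G) (U : Multiset G) {s : G} (hs : s ∈ subsums U) :
    x + s ∈ subsums (x ::ₘ U) := by
  obtain ⟨T, hT, rfl⟩ := hs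
  exact ⟨x ::ₘ T, Multiset.cons_le_cons x hT, by simp⟩

/-- If `x` gave no new subsum, the subsums of `U` would be closed under adding `x`. They would then
contain `-x`, and `x` would complete a zero sum. -/
theorem ncard_subsums_cons [Finite G] (x : G) (U : Multiset G) (h : ZeroSumFree (x ::ₘ U)) :
    (subsums U).ncard + 1 ≤ (subsums (x ::ₘ U)).ncard := by
  refine Set.ncard_lt_ncard ⟨subsums_mono (Multiset.le_cons_self U x), fun hsub => ?_⟩
    (subsums_finite _)
  have step : ∀ k : ℕ, k • x ∈ subsums U := by
    intro k
    induction k with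
    | zero => simpa using zero_mem_subsums U
    | succ k ih =>
      rw [succ_nsmul']
      exact hsub (add_mem_subsums_cons x U ih)
  have hpos := addOrderOf_pos x
  -- The multiple `(addOrderOf x - 1) • x` is `-x`.
  obtain ⟨T, hT, hTs⟩ := step (addOrderOf x - 1)
  refine h (x ::ₘ T) (Multiset.cons_le_cons x hT) (Multiset.cons_ne_zero) ?_
  rw [Multiset.sum_cons, hTs, ← succ_nsmul', Nat.sub_add_cancel hpos, addOrderOf_nsmul_eq_zero]

theorem ncard_subsums_add [Finite G] (U X : Multiset G) (h : ZeroSumFree (U + X)) :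
    (subsums X).ncard + U.card ≤ (subsums (U + X)).ncard := by
  induction U using Multiset.induction with
  | empty => simp
  | cons x U ih =>
    rw [Multiset.cons_add] at h ⊢
    have := ncard_subsums_cons x _ h
    have := ih (h.mono (Multiset.le_cons_self _ _))
    rw [Multiset.card_cons]
    omega

theorem subsums_subset (K : AddSubgroup G) {U : Multiset G} (hU : ∀ x ∈ U, x ∈ K) :
    subsums U ⊆ K := by
  rintro s ⟨T, hT, rfl⟩
  exact AddSubgroup.multiset_sum_mem K T fun x hx => hU x (Multiset.mem_of_le hT hx)

theorem ncard_subsums_le [Finite G] (K : AddSubgroup G) {U : Multiset G}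
    (hU : ∀ x ∈ U, x ∈ K) : (subsums U).ncard ≤ Nat.card K :=
  Set.ncard_le_ncard (subsums_subset K hU)

theorem ZeroSumFree.card_lt [Finite G] (K : AddSubgroup G) {U : Multiset G}
    (hU : ∀ x ∈ U, x ∈ K) (h : ZeroSumFree U) : U.card + 1 ≤ Nat.card K := by
  have h1 := ncard_subsums_add U 0 (by simpa using h)
  have h2 := ncard_subsums_le K hU
  have h3 : 1 ≤ (subsums (0 : Multiset G)).ncard := by
    exact (Set.ncard_pos (subsums_finite _)).2 ⟨0, zero_mem_subsums _⟩
  rw [add_zero] at h1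
  omega

theorem ZeroSumFree.ne_zero {U : Multiset G} (h : ZeroSumFree U) {x : G} (hx : x ∈ U) : x ≠ 0 := by
  simpa using h {x} (by simpa using hx) (by simp)

/-- Two distinct terms already have the four subsums `0, x, y, x + y`, one more than two terms need;
each other term adds at least one, which exceeds the order of `K`. -/
theorem ZeroSumFree.eq_of_card [Finite G] (K : AddSubgroup G) {U : Multiset G}
    (hU : ∀ x ∈ U, x ∈ K) (h : ZeroSumFree U) (hc : U.card + 1 = Nat.card K) {x y : G}
    (hx : x ∈ U) (hy : y ∈ U) : x = y := by
  classical
  by_contra hxy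
  obtain ⟨U₁, rfl⟩ := Multiset.exists_cons_of_mem hx
  have hy' : y ∈ U₁ := (Multiset.mem_cons.1 hy).resolve_left (Ne.symm hxy)
  obtain ⟨U₂, rfl⟩ := Multiset.exists_cons_of_mem hy'
  have e : x ::ₘ y ::ₘ U₂ = U₂ + {x, y} := by
    rw [add_comm, Multiset.insert_eq_cons, Multiset.cons_add, Multiset.singleton_add]
  have hx0 := h.ne_zero hx
  have hy0 := h.ne_zero hy
  rw [e] at h hU hc
  have h1 := ncard_subsums_add U₂ {x, y} h
  have h2 := ncard_subsums_le K hU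
  have h0 : x + y ≠ 0 := by
    simpa using h {x, y} (Multiset.le_add_left _ _) (by simp)
  have h3 : 4 ≤ (subsums ({x, y} : Multiset G)).ncard := by
    have hs : (({0, x, y, x + y} : Finset G) : Set G) ⊆ subsums ({x, y} : Multiset G) := by
      intro s hs
      simp only [Finset.coe_insert, Finset.coe_singleton, Set.mem_insert_iff,
        Set.mem_singleton_iff] at hs
      rcases hs with rfl | rfl | rfl | rfl
      · exact zero_mem_subsums _
      · exact ⟨{s}, by simp, by simp⟩
      · exact ⟨{s}, by simp, by simp⟩
      · exact ⟨{x, y}, le_rfl, by simp⟩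
    have hle := Set.ncard_le_ncard hs (subsums_finite _)
    rw [Set.ncard_coe_finset] at hle
    have : ({0, x, y, x + y} : Finset G).card = 4 := by
      rw [Finset.card_eq_of_equiv_fin]
      refine (Finset.equivFinOfCardEq ?_)
      rw [Finset.card_insert_of_notMem, Finset.card_insert_of_notMem,
        Finset.card_insert_of_notMem, Finset.card_singleton] <;>
      simp [*, Ne.symm hx0, Ne.symm hy0, Ne.symm h0]
    omega
  rw [Multiset.card_add] at hc
  simp only [Multiset.insert_eq_cons, Multiset.card_cons, Multiset.card_singleton] at hc
  omega

theorem ZeroSumFree.addOrderOf_eq [Finite G] (K : AddSubgroup G) {U : Multiset G}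
    (hU : ∀ x ∈ U, x ∈ K) (h : ZeroSumFree U) (hc : U.card + 1 = Nat.card K) {x : G}
    (hx : x ∈ U) : addOrderOf x = Nat.card K := by
  have hrep : U = Multiset.replicate U.card x :=
    Multiset.eq_replicate.2 ⟨rfl, fun y hy => h.eq_of_card K hU hc hy hx⟩
  have hdvd : addOrderOf x ∣ Nat.card K := K.addOrderOf_dvd_natCard (hU x hx)
  have hle := Nat.le_of_dvd (Nat.card_pos) hdvd
  have hpos := addOrderOf_pos x
  by_contra hne
  refine h (Multiset.replicate (addOrderOf x) x) ?_ ?_ ?_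
  · exact ((Multiset.replicate_le_replicate x).2 (by omega)).trans hrep.ge
  · intro h0
    have := congrArg Multiset.card h0
    rw [Multiset.card_replicate, Multiset.card_zero] at this
    omega
  · simp [addOrderOf_nsmul_eq_zero]

/-- Both completions are constant, so `x` and `y` equal any term of `U`. If `U` is empty, `K` has
order 2 and a single nonzero element. -/
theorem ZeroSumFree.completion_unique [Finite G] (K : AddSubgroup G) {U : Multiset G} {x y : G}
    (hU : ∀ z ∈ U, z ∈ K) (hx : x ∈ K) (hy : y ∈ K) (hfx : ZeroSumFree (x ::ₘ U))
    (hfy : ZeroSumFree (y ::ₘ U)) (hc : U.card + 2 = Nat.card K) : x = y := by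
  have hUx : ∀ z ∈ x ::ₘ U, z ∈ K := by simpa [hx] using hU
  have hUy : ∀ z ∈ y ::ₘ U, z ∈ K := by simpa [hy] using hU
  have hcx : (x ::ₘ U).card + 1 = Nat.card K := by simpa using hc
  have hcy : (y ::ₘ U).card + 1 = Nat.card K := by simpa using hc
  rcases U.empty_or_exists_mem with rfl | ⟨z, hz⟩
  · by_contra hne
    have hx0 := hfx.ne_zero (Multiset.mem_cons_self x 0)
    have hy0 := hfy.ne_zero (Multiset.mem_cons_self y 0)
    have hs : ({0, x, y} : Set G) ⊆ K := by
      rintro z (rfl | rfl | rfl)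
      exacts [K.zero_mem, hx, hy]
    have hle := Set.ncard_le_ncard hs (Set.toFinite _)
    rw [Set.ncard_eq_three.2 ⟨0, x, y, hx0.symm, hy0.symm, hne, rfl⟩] at hle
    change 3 ≤ Nat.card K at hle
    simp at hc
    omega
  · exact (hfx.eq_of_card K hUx hcx (Multiset.mem_cons_self x U) (Multiset.mem_cons_of_mem hz)).trans
      (hfy.eq_of_card K hUy hcy (Multiset.mem_cons_self y U) (Multiset.mem_cons_of_mem hz)).symm

theorem exists_le_of_le_map {α β : Type*} (f : α → β) {A : Multiset α} {T : Multiset β}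
    (h : T ≤ A.map f) : ∃ A' ≤ A, A'.map f = T := by
  induction A using Multiset.induction generalizing T with
  | empty => exact ⟨0, le_rfl, by simpa using (Multiset.le_zero.1 (by simpa using h)).symm⟩
  | cons a A ih =>
    rw [Multiset.map_cons] at h
    by_cases ha : f a ∈ T
    · obtain ⟨T', rfl⟩ := Multiset.exists_cons_of_mem ha
      obtain ⟨A', hA', rfl⟩ := ih ((Multiset.cons_le_cons_iff _).1 h)
      exact ⟨a ::ₘ A', Multiset.cons_le_cons _ hA', by simp⟩
    · obtain ⟨A', hA', rfl⟩ := ih ((Multiset.le_cons_of_notMem ha).1 h)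
      exact ⟨A', hA'.trans (Multiset.le_cons_self _ _), rfl⟩

theorem sum_map_sum (B : Multiset (Multiset G)) : (B.map Multiset.sum).sum = B.sum.sum := by
  induction B using Multiset.induction with
  | empty => simp
  | cons X B ih => simp [ih]

theorem sum_le_sum_of_le {α : Type*} {B' B : Multiset (Multiset α)} (h : B' ≤ B) : B'.sum ≤ B.sum := by
  obtain ⟨C, rfl⟩ := Multiset.le_iff_exists_add.1 h
  rw [Multiset.sum_add]
  exact Multiset.le_add_right _ _

/-- A zero sum among the sums of the members of `B` concatenates to a zero-sum subsequence of `S`,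
short by the length bound. -/
theorem zeroSumFree_map_sum {S : Multiset G} (hS : ¬ HasShortZeroSum S)
    {B : Multiset (Multiset G)} (hB : B.sum ≤ S) (hne : ∀ X ∈ B, X ≠ 0)
    (hc : B.sum.card ≤ AddMonoid.exponent G) : ZeroSumFree (B.map Multiset.sum) := by
  intro T hT hT0 hTs
  obtain ⟨B', hB', rfl⟩ := exists_le_of_le_map _ hT
  have hle := sum_le_sum_of_le hB'
  refine hS ⟨B'.sum, hle.trans hB, ?_, (Multiset.card_le_card hle).trans hc, ?_⟩
  · rcases B'.empty_or_exists_mem with rfl | ⟨X, hX⟩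
    · simp at hT0
    · intro h0
      obtain ⟨C, rfl⟩ := Multiset.exists_cons_of_mem hX
      rw [Multiset.sum_cons] at h0
      refine hne X (Multiset.mem_of_le hB' hX) (Multiset.le_zero.1 ?_)
      rw [← h0]
      exact Multiset.le_add_right _ _
  · rw [← sum_map_sum, hTs]

end ZeroSum

namespace ZeroSum

/-! ### Lines in the elementary 2-group of order 8 -/

section ElementaryTwoGroup

variable {V : Type*} [AddCommGroup V]

theorem eq_of_independent_of_card_eight (h : ∀ v : V, v + v = 0) (hV : Nat.card V = 8) {r a c : V}
    (hr : r ≠ 0) (ha : a ≠ 0) (har : a ≠ r) (hc : c ≠ 0) (hcr : c ≠ r) (hca : c ≠ a)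
    (hcb : c ≠ r + a) (z : V) :
    z = 0 ∨ z = r ∨ z = a ∨ z = r + a ∨ z = c ∨ z = r + c ∨ z = a + c ∨ z = r + (a + c) := by
  classical
  have : Finite V := Nat.finite_of_card_ne_zero (by omega)
  have := Fintype.ofFinite V
  have hs : ({0, r, a, r + a, c, r + c, a + c, r + (a + c)} : Finset V).card = 8 := by
    have := h r; have := h a; have := h c
    repeat rw [Finset.card_insert_of_notMem]
    · simp
    all_goals simp only [Finset.mem_insert, Finset.mem_singleton, not_or]
    all_goals and_intros
    all_goals grind
  have hu := Finset.eq_univ_of_card _ (hs.trans (hV.symm.trans Nat.card_eq_fintype_card))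
  have hz := Finset.mem_univ z
  rw [← hu] at hz
  simpa using hz

/-- Five distinct nonzero elements of an elementary `2`-group of order `8` lie on two lines
(sum-zero triples) with a common element. -/
theorem exists_two_lines (h : ∀ v : V, v + v = 0) (hV : Nat.card V = 8) {M : Multiset V}
    (hM : M.Nodup) (h0 : 0 ∉ M) (hc : M.card = 5) :
    ∃ r a b c d, M = {r, a, b, c, d} ∧ r + a = b ∧ r + c = d := by
  classical
  have : Finite V := Nat.finite_of_card_ne_zero (by omega)
  have := Fintype.ofFinite V
  have hcompl : (insert 0 M.toFinset)ᶜ.card = 2 := by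
    rw [Finset.card_compl, Finset.card_insert_of_notMem (by simpa using h0),
      Multiset.toFinset_card_of_nodup hM, hc, ← Nat.card_eq_fintype_card, hV]
  obtain ⟨p, q, hpq, hs⟩ := Finset.card_eq_two.1 hcompl
  have hmem : ∀ v, v ≠ 0 → v ≠ p → v ≠ q → v ∈ M := by
    intro v hv0 hvp hvq
    by_contra hv
    have : v ∈ (insert 0 M.toFinset)ᶜ := by simp [hv0, hv]
    rw [hs] at this
    simp [hvp, hvq] at this
  have hp : p ∈ (insert 0 M.toFinset)ᶜ := by simp [hs]
  have hq : q ∈ (insert 0 M.toFinset)ᶜ := by simp [hs]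
  simp only [Finset.mem_compl, Finset.mem_insert, Multiset.mem_toFinset, not_or] at hp hq
  have h2p := h p
  have h2q := h q
  -- With `p, q` the two missing nonzero points, the other two lines through `p + q` avoid both, so
  -- they lie in `M`.
  have hr : p + q ∈ M := hmem _ (by grind) (by grind) (by grind)
  have step : ∀ a ∈ M, a ≠ p + q → p + q + a ∈ M ∧ p + q + a ≠ a ∧ p + q + a ≠ p + q := by
    intro a ha har
    have ha0 : a ≠ 0 := fun e => h0 (e ▸ ha)
    have hap : a ≠ p := fun e => hp.2 (e ▸ ha)
    have haq : a ≠ q := fun e => hq.2 (e ▸ ha)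
    have h2a := h a
    exact ⟨hmem _ (by grind) (by grind) (by grind), by grind, by grind⟩
  obtain ⟨M₁, rfl⟩ := Multiset.exists_cons_of_mem hr
  rw [Multiset.nodup_cons] at hM
  obtain ⟨a, ha⟩ : ∃ a, a ∈ M₁ := Multiset.card_pos_iff_exists_mem.1 (by simp at hc; omega)
  have har : a ≠ p + q := fun e => hM.1 (e ▸ ha)
  obtain ⟨hb, hba, hbr⟩ := step a (Multiset.mem_cons_of_mem ha) har
  have hb := (Multiset.mem_cons.1 hb).resolve_left hbr
  obtain ⟨M₂, rfl⟩ := Multiset.exists_cons_of_mem ha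
  have hb := (Multiset.mem_cons.1 hb).resolve_left hba
  obtain ⟨M₃, rfl⟩ := Multiset.exists_cons_of_mem hb
  obtain ⟨c, hcm⟩ : ∃ c, c ∈ M₃ := Multiset.card_pos_iff_exists_mem.1 (by simp at hc; omega)
  obtain ⟨M₄, rfl⟩ := Multiset.exists_cons_of_mem hcm
  simp only [Multiset.nodup_cons, Multiset.mem_cons, not_or] at hM
  obtain ⟨hd, hdc, hdr⟩ := step c (by simp) (by tauto)
  have hd : p + q + c ∈ M₄ := by
    have h2a := h a
    have : p + q + c ≠ a := by grind
    have : p + q + c ≠ p + q + a := by grind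
    simp only [Multiset.mem_cons] at hd
    tauto
  obtain ⟨M₅, rfl⟩ := Multiset.exists_cons_of_mem hd
  have : M₅ = 0 := by
    simpa using hc
  subst this
  exact ⟨p + q, a, p + q + a, c, p + q + c, rfl, rfl, rfl⟩

end ElementaryTwoGroup

/-! ### Reduction modulo 2 and block sums -/

variable {G V : Type*} [AddCommGroup G] [AddCommGroup V] {π : G →+ V} {n : ℕ}

/-- A homomorphism onto an elementary `2`-group of order `8` with kernel of order `n`, from a
group of exponent `2 * n`. -/
structure Reduction (π : G →+ V) (n : ℕ) : Prop where
  two_le : 2 ≤ n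
  card_ker : Nat.card π.ker = n
  exponent : AddMonoid.exponent G = 2 * n
  add_self : ∀ v : V, v + v = 0
  card_codomain : Nat.card V = 8

theorem exists_two_lines_of_map (hR : Reduction π n) {Y : Multiset G} (hY : (Y.map π).Nodup)
    (h0 : 0 ∉ Y.map π) (hc : Y.card = 5) :
    ∃ r a b c d, Y = {r, a, b, c, d} ∧ π r + π a = π b ∧ π r + π c = π d := by
  classical
  obtain ⟨r, a, b, c, d, hM, h1, h2⟩ :=
    exists_two_lines hR.add_self hR.card_codomain hY h0 (by simpa using hc)
  simp only [Multiset.insert_eq_cons] at hM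
  obtain ⟨r', hr, rfl, hM₁⟩ := (Multiset.map_eq_cons _ _ _ _).2 hM
  obtain ⟨a', ha, rfl, hM₂⟩ := (Multiset.map_eq_cons _ _ _ _).2 hM₁
  obtain ⟨b', hb, rfl, hM₃⟩ := (Multiset.map_eq_cons _ _ _ _).2 hM₂
  obtain ⟨c', hc', rfl, hM₄⟩ := (Multiset.map_eq_cons _ _ _ _).2 hM₃
  obtain ⟨d', hd, rfl⟩ := Multiset.map_eq_singleton.1 hM₄
  refine ⟨r', a', b', c', d', ?_, h1, h2⟩
  rw [← Multiset.cons_erase hr, ← Multiset.cons_erase ha, ← Multiset.cons_erase hb,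
    ← Multiset.cons_erase hc', hd]
  simp only [Multiset.insert_eq_cons]

theorem nodup_map_or_exists_pair {α β : Type*} (f : α → β) (W : Multiset α) :
    (W.map f).Nodup ∨ ∃ x y W', W = {x, y} + W' ∧ f x = f y := by
  classical
  by_cases h : (W.map f).Nodup
  · exact Or.inl h
  · rw [Multiset.nodup_iff_ne_cons_cons] at h
    push Not at h
    obtain ⟨v, t, ht⟩ := h
    obtain ⟨x, hx, rfl, ht⟩ := (Multiset.map_eq_cons _ _ _ _).2 ht
    obtain ⟨y, hy, hxy, ht⟩ := (Multiset.map_eq_cons _ _ _ _).2 ht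
    refine Or.inr ⟨x, y, (W.erase x).erase y, ?_, hxy.symm⟩
    rw [Multiset.insert_eq_cons, Multiset.cons_add, Multiset.singleton_add, Multiset.cons_erase hy,
      Multiset.cons_erase hx]

/-- The multiset `B` consists of `n - 2` pairs whose two elements have the same image, and `W` is
disjoint from these pairs within `S`. -/
structure Peeled (π : G →+ V) (n : ℕ) (S : Multiset G) (B : Multiset (Multiset G))
    (W : Multiset G) : Prop where
  pair : ∀ P ∈ B, ∃ x y, P = {x, y} ∧ π x = π y
  card : B.card + 2 = n
  le : B.sum + W ≤ S

/-- A nonempty sequence with sum in the kernel of `π`. -/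
structure IsBlock (π : G →+ V) (X : Multiset G) : Prop where
  ne_zero : X ≠ 0
  sum_mem : π X.sum = 0

theorem IsBlock.of_pair (hR : Reduction π n) {x y : G} (h : π x = π y) :
    IsBlock π ({x, y} : Multiset G) :=
  ⟨by simp, by simp [h, hR.add_self]⟩

theorem card_sum_of_pair {B : Multiset (Multiset G)}
    (hB : ∀ P ∈ B, ∃ x y, P = {x, y} ∧ π x = π y) : B.sum.card = 2 * B.card := by
  induction B using Multiset.induction with
  | empty => simp
  | cons P B ih =>
    obtain ⟨x, y, rfl, -⟩ := hB P (Multiset.mem_cons_self _ _)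
    have := ih fun Q hQ => hB Q (Multiset.mem_cons_of_mem hQ)
    simp [this]
    ring

variable {S W : Multiset G} {B : Multiset (Multiset G)}

theorem Peeled.isBlock (hR : Reduction π n) (hP : Peeled π n S B W) {P : Multiset G}
    (h : P ∈ B) : IsBlock π P := by
  obtain ⟨x, y, rfl, hxy⟩ := hP.pair P h
  exact IsBlock.of_pair hR hxy

theorem mem_ker_of_blocks {C : Multiset (Multiset G)} (hC : ∀ X ∈ C, IsBlock π X) :
    ∀ z ∈ C.map Multiset.sum, z ∈ π.ker := by
  intro z hz
  obtain ⟨X, hX, rfl⟩ := Multiset.mem_map.1 hz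
  exact (hC X hX).sum_mem

/-- The total length is at most `2 * (n - 2) + 4 = 2 * n`, which is why blocks are limited to four
elements. -/
theorem Peeled.zeroSumFree (hR : Reduction π n) (hS : ¬ HasShortZeroSum S)
    (hP : Peeled π n S B W) {X : Multiset G} (hX : IsBlock π X) (hle : X ≤ W) (hc : X.card ≤ 4) :
    ZeroSumFree (X.sum ::ₘ B.map Multiset.sum) := by
  rw [← Multiset.map_cons]
  refine zeroSumFree_map_sum hS ?_ ?_ ?_
  · rw [Multiset.sum_cons, add_comm]
    exact le_trans (by gcongr) hP.le
  · simp only [Multiset.mem_cons, forall_eq_or_imp]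
    exact ⟨hX.ne_zero, fun P h => (hP.isBlock hR h).ne_zero⟩
  · rw [Multiset.sum_cons, Multiset.card_add, card_sum_of_pair hP.pair, hR.exponent]
    have := hP.card
    omega

variable [Finite G]

theorem Peeled.block_sum_eq (hR : Reduction π n) (hS : ¬ HasShortZeroSum S)
    (hP : Peeled π n S B W) {X Y : Multiset G} (hX : IsBlock π X) (hXle : X ≤ W)
    (hXc : X.card ≤ 4) (hY : IsBlock π Y) (hYle : Y ≤ W) (hYc : Y.card ≤ 4) : X.sum = Y.sum :=
  ZeroSumFree.completion_unique π.ker (mem_ker_of_blocks fun _ h => hP.isBlock hR h)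
    hX.sum_mem hY.sum_mem (hP.zeroSumFree hR hS hX hXle hXc) (hP.zeroSumFree hR hS hY hYle hYc)
    (by rw [hR.card_ker, Multiset.card_map, hP.card])

theorem Peeled.addOrderOf_block_sum (hR : Reduction π n) (hS : ¬ HasShortZeroSum S)
    (hP : Peeled π n S B W) {X : Multiset G} (hX : IsBlock π X) (hXle : X ≤ W)
    (hXc : X.card ≤ 4) : addOrderOf X.sum = n := by
  rw [← hR.card_ker]
  refine (hP.zeroSumFree hR hS hX hXle hXc).addOrderOf_eq π.ker ?_ ?_ (Multiset.mem_cons_self _ _)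
  · simp only [Multiset.mem_cons, forall_eq_or_imp]
    exact ⟨hX.sum_mem, mem_ker_of_blocks fun _ h => hP.isBlock hR h⟩
  · rw [hR.card_ker, Multiset.card_cons, Multiset.card_map, ← hP.card]

/-- Together with the `n - 2` pairs they would give `n` zero-sum free terms in a kernel of order
`n`. -/
theorem Peeled.not_two_blocks (hR : Reduction π n) (hS : ¬ HasShortZeroSum S)
    (hP : Peeled π n S B W) {X Y : Multiset G} (hX : IsBlock π X) (hY : IsBlock π Y)
    (hle : X + Y ≤ W) (hc : X.card + Y.card ≤ 4) : False := by
  have hblock : ∀ Z ∈ X ::ₘ Y ::ₘ B, IsBlock π Z := by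
    simp only [Multiset.mem_cons, forall_eq_or_imp]
    exact ⟨hX, hY, fun P h => hP.isBlock hR h⟩
  have hfree : ZeroSumFree ((X ::ₘ Y ::ₘ B).map Multiset.sum) := by
    refine zeroSumFree_map_sum hS ?_ (fun Z h => (hblock Z h).ne_zero) ?_
    · rw [Multiset.sum_cons, Multiset.sum_cons, ← add_assoc, add_comm]
      exact le_trans (by gcongr) hP.le
    · rw [Multiset.sum_cons, Multiset.sum_cons, Multiset.card_add, Multiset.card_add,
        card_sum_of_pair hP.pair, hR.exponent]
      have := hP.card
      omega
  have := hfree.card_lt π.ker (mem_ker_of_blocks hblock)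
  rw [hR.card_ker, Multiset.card_map, Multiset.card_cons, Multiset.card_cons] at this
  have := hP.card
  omega

end ZeroSum

/-! ### The elements left after peeling -/

namespace ZeroSum

variable {G V : Type*} [AddCommGroup G] [AddCommGroup V] {π : G →+ V} {n : ℕ}
variable {S W : Multiset G} {B : Multiset (Multiset G)}

theorem exists_le_card_eq {α : Type*} {k : ℕ} {S : Multiset α} (h : k ≤ S.card) :
    ∃ T ≤ S, T.card = k := by
  induction S using Multiset.induction generalizing k with
  | empty => exact ⟨0, le_rfl, by simpa using h.antisymm (Nat.zero_le _) |>.symm⟩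
  | cons a S ih =>
    rcases h.lt_or_eq with h | h
    · rw [Multiset.card_cons] at h
      obtain ⟨T, hT, hc⟩ := ih (Nat.lt_succ_iff.1 h)
      exact ⟨T, hT.trans (Multiset.le_cons_self _ _), hc⟩
    · exact ⟨_, le_rfl, h.symm⟩

/-- Before each removal at least nine elements remain for eight classes, so two share a class. -/
theorem exists_pairs {G V : Type*} (hV : Nat.card V = 8) (π : G → V) (k : ℕ) (S : Multiset G)
    (hS : 2 * k + 7 ≤ S.card) :
    ∃ (B : Multiset (Multiset G)) (W : Multiset G),
      (∀ P ∈ B, ∃ x y, P = {x, y} ∧ π x = π y) ∧ B.card = k ∧ B.sum + W = S := by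
  classical
  induction k generalizing S with
  | zero => exact ⟨0, S, by simp, rfl, by simp⟩
  | succ k ih =>
    rcases nodup_map_or_exists_pair π S with h | ⟨x, y, S', rfl, hxy⟩
    · have : Finite V := Nat.finite_of_card_ne_zero (by omega)
      have := Fintype.ofFinite V
      have h1 := (Multiset.toFinset (S.map π)).card_le_univ
      rw [Multiset.toFinset_card_of_nodup h, ← Nat.card_eq_fintype_card, hV,
        Multiset.card_map] at h1
      omega
    · obtain ⟨B, W, hB, hk, rfl⟩ := ih S' (by simp at hS; omega)
      refine ⟨{x, y} ::ₘ B, W, ?_, by simp [hk], by simp⟩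
      simp only [Multiset.mem_cons, forall_eq_or_imp]
      exact ⟨⟨x, y, rfl, hxy⟩, hB⟩

variable [Finite G]

/-- The six classes are the Fano plane without one point. They contain four lines and three
four-point blocks, and each point lies on two of either kind. If `g` is the common block sum,
counting gives `4g = 3g`, so `g = 0`, although `g` has order `n ≥ 2`. -/
theorem Peeled.not_six_points (hR : Reduction π n) (hS : ¬ HasShortZeroSum S)
    (hP : Peeled π n S B W) {p r a b c d : G} (hle : ({p, r, a, b, c, d} : Multiset G) ≤ W)
    (hp : π p = π a + π c) (hb : π r + π a = π b) (hd : π r + π c = π d) : False := by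
  have h2r := hR.add_self (π r)
  have h2a := hR.add_self (π a)
  have h2c := hR.add_self (π c)
  have key : ∀ X Z : Multiset G, {p, r, a, b, c, d} = X + Z → IsBlock π X → X.card ≤ 4 →
      X.sum = r + (a + b) := by
    intro X Z hXZ hX hc
    have := hP.block_sum_eq hR hS hX ((Multiset.le_add_right X Z).trans (hXZ ▸ hle)) hc
      (Y := {r, a, b}) ⟨by simp, by simp; grind⟩
      (le_trans ((Multiset.le_add_right _ {p, c, d}).trans_eq (by
        simp only [Multiset.insert_eq_cons, ← Multiset.singleton_add]; abel)) hle) (by simp)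
    simpa using this
  have h1 := key {p, a, c} {r, b, d} (by
    simp only [Multiset.insert_eq_cons, ← Multiset.singleton_add]; abel)
    ⟨by simp, by simp; grind⟩ (by simp)
  have h2 := key {p, b, d} {r, a, c} (by
    simp only [Multiset.insert_eq_cons, ← Multiset.singleton_add]; abel)
    ⟨by simp, by simp; grind⟩ (by simp)
  have h3 := key {a, b, c, d} {p, r} (by
    simp only [Multiset.insert_eq_cons, ← Multiset.singleton_add]; abel)
    ⟨by simp, by simp; grind⟩ (by simp)
  have h4 := key {p, r, b, c} {a, d} (by
    simp only [Multiset.insert_eq_cons, ← Multiset.singleton_add]; abel)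
    ⟨by simp, by simp; grind⟩ (by simp)
  have h5 := key {p, r, a, d} {b, c} (by
    simp only [Multiset.insert_eq_cons, ← Multiset.singleton_add]; abel)
    ⟨by simp, by simp; grind⟩ (by simp)
  have h6 := key {r, c, d} {p, a, b} (by
    simp only [Multiset.insert_eq_cons, ← Multiset.singleton_add]; abel)
    ⟨by simp, by simp; grind⟩ (by simp)
  simp only [Multiset.insert_eq_cons, Multiset.sum_cons, Multiset.sum_singleton] at h1 h2 h3 h4 h5 h6
  have h0 : r + (a + b) = 0 := by
    linear_combination (norm := module) h4 + h5 - h6 - h1 - h2 + h3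
  have hord := hP.addOrderOf_block_sum hR hS (X := {r, a, b}) ⟨by simp, by simp; grind⟩
      (le_trans ((Multiset.le_add_right _ {p, c, d}).trans_eq (by
        simp only [Multiset.insert_eq_cons, ← Multiset.singleton_add]; abel)) hle) (by simp)
  have h1n := hR.two_le
  simp [h0] at hord
  omega

theorem Peeled.not_six_classes (hR : Reduction π n) (hS : ¬ HasShortZeroSum S)
    (hP : Peeled π n S B W) {Y : Multiset G} (hle : Y ≤ W) (hc : Y.card = 6)
    (hY : (Y.map π).Nodup) (h0 : 0 ∉ Y.map π) : False := by
  obtain ⟨p, hp⟩ : ∃ p, p ∈ Y := Multiset.card_pos_iff_exists_mem.1 (by omega)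
  obtain ⟨Y, rfl⟩ := Multiset.exists_cons_of_mem hp
  rw [Multiset.map_cons] at hY h0
  obtain ⟨r, a, b, c, d, rfl, hb, hd⟩ := exists_two_lines_of_map hR
    (Multiset.nodup_cons.1 hY).2 (fun h => h0 (Multiset.mem_cons_of_mem h)) (by simpa using hc)
  simp [-Multiset.mem_map, ← hb, ← hd] at hY h0
  have h2r := hR.add_self (π r)
  have h2a := hR.add_self (π a)
  have h2c := hR.add_self (π c)
  -- The sixth class can only be `a + c` or `r + a + c`; the latter is `a + d`, so exchanging `c`
  -- and `d` reduces it to the former.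
  rcases eq_of_independent_of_card_eight hR.add_self hR.card_codomain (r := π r) (a := π a)
    (c := π c) (by grind) (by grind) (by grind) (by grind) (by grind) (by grind) (by grind) (π p)
    with h | h | h | h | h | h | h | h
  · grind
  · grind
  · grind
  · grind
  · grind
  · grind
  · exact hP.not_six_points hR hS hle h hb hd
  · refine hP.not_six_points hR hS (p := p) (r := r) (a := a) (b := b) (c := d) (d := c)
      (le_trans (le_of_eq ?_) hle) (by grind) hb (by grind)
    simp only [Multiset.insert_eq_cons, ← Multiset.singleton_add]
    abel

/-- An element of the kernel is a block of length one. Among six others there is a pair, another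
kernel element, or six distinct nonzero classes. -/
theorem Peeled.zero_notMem (hR : Reduction π n) (hS : ¬ HasShortZeroSum S)
    (hP : Peeled π n S B W) (hc : 7 ≤ W.card) : 0 ∉ W.map π := by
  intro h
  obtain ⟨w, hw, hw0⟩ := Multiset.mem_map.1 h
  obtain ⟨W, rfl⟩ := Multiset.exists_cons_of_mem hw
  have hwb : IsBlock π ({w} : Multiset G) := ⟨by simp, by simpa using hw0⟩
  rcases nodup_map_or_exists_pair π W with hn | ⟨x, y, W, rfl, hxy⟩
  · rw [Multiset.card_cons] at hc
    obtain ⟨Y, hY, hY6⟩ := exists_le_card_eq (k := 6) (S := W) (by omega)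
    refine hP.not_six_classes hR hS (hY.trans (Multiset.le_cons_self _ _)) hY6
      (Multiset.nodup_of_le (Multiset.map_le_map hY) hn) fun h0 => ?_
    obtain ⟨y, hy, hy0⟩ := Multiset.mem_map.1 h0
    refine hP.not_two_blocks hR hS hwb (Y := {y}) ⟨by simp, by simpa using hy0⟩ ?_ (by simp)
    rw [Multiset.singleton_add]
    exact Multiset.cons_le_cons _ (Multiset.singleton_le.2 (Multiset.mem_of_le hY hy))
  · refine hP.not_two_blocks hR hS hwb (IsBlock.of_pair hR hxy) ?_ (by simp)
    rw [Multiset.singleton_add]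
    exact Multiset.cons_le_cons _ (Multiset.le_add_right _ _)

theorem Peeled.exists_pair (hR : Reduction π n) (hS : ¬ HasShortZeroSum S)
    (hP : Peeled π n S B W) (hc : 7 ≤ W.card) :
    ∃ u v Y, W = {u, v} + Y ∧ π u = π v ∧ (Y.map π).Nodup ∧ Y.card = 5 := by
  have h0 := hP.zero_notMem hR hS hc
  have hsix : ∀ Y ≤ W, (Y.map π).Nodup → Y.card < 6 := by
    intro Y hY hn
    by_contra! hY6
    obtain ⟨Z, hZ, hZ6⟩ := exists_le_card_eq hY6
    exact hP.not_six_classes hR hS (hZ.trans hY) hZ6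
      (Multiset.nodup_of_le (Multiset.map_le_map hZ) hn)
      fun h => h0 (Multiset.mem_of_le (Multiset.map_le_map (hZ.trans hY)) h)
  rcases nodup_map_or_exists_pair π W with hn | ⟨u, v, Y, rfl, huv⟩
  · have := hsix W le_rfl hn
    omega
  · rcases nodup_map_or_exists_pair π Y with hn | ⟨x, y, Y, rfl, hxy⟩
    · have := hsix Y (Multiset.le_add_left _ _) hn
      refine ⟨u, v, Y, rfl, huv, hn, ?_⟩
      simp at hc
      omega
    · refine (hP.not_two_blocks hR hS (IsBlock.of_pair hR huv) (IsBlock.of_pair hR hxy) ?_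
        (by simp)).elim
      rw [← add_assoc]
      exact Multiset.le_add_right _ _

theorem Peeled.card_lt (hR : Reduction π n) (hS : ¬ HasShortZeroSum S)
    (hP : Peeled π n S B W) : W.card < 8 := by
  by_contra! hc
  obtain ⟨u, v, Y, rfl, -, -, h5⟩ := hP.exists_pair hR hS (by omega)
  simp [h5] at hc

/-- The class of `u` must recur in `Y`, to avoid six classes. Among three elements of one class any
two form a block, and equal pair sums make the three equal. -/
theorem Peeled.pair_eq (hR : Reduction π n) (hS : ¬ HasShortZeroSum S) {u v : G}
    {Y : Multiset G} (hP : Peeled π n S B ({u, v} + Y)) (huv : π u = π v)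
    (hY : (Y.map π).Nodup) (hc : Y.card = 5) : u ∈ Y ∧ v = u := by
  have h0 := hP.zero_notMem hR hS (by simp [hc])
  have hu : π u ∈ Y.map π := by
    by_contra hu
    refine hP.not_six_classes hR hS (Y := u ::ₘ Y) ?_ (by simp [hc]) ?_ ?_
    · rw [← Multiset.singleton_add]
      exact add_le_add_left (by simp) _
    · rw [Multiset.map_cons]
      exact Multiset.nodup_cons.2 ⟨hu, hY⟩
    · intro h
      refine h0 (Multiset.mem_of_le (Multiset.map_le_map ?_) h)
      rw [← Multiset.singleton_add]
      exact add_le_add_left (by simp) _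
  obtain ⟨y, hy, hyu⟩ := Multiset.mem_map.1 hu
  obtain ⟨Y, rfl⟩ := Multiset.exists_cons_of_mem hy
  have e : ({u, v} : Multiset G) + y ::ₘ Y = {u, v, y} + Y := by
    simp only [Multiset.insert_eq_cons, ← Multiset.singleton_add]; abel
  rw [e] at hP
  have h1 : ({u, v} : Multiset G) ≤ {u, v, y} + Y :=
    le_trans ((Multiset.le_add_right _ {y}).trans_eq (by
      simp only [Multiset.insert_eq_cons, ← Multiset.singleton_add]; abel))
      (Multiset.le_add_right _ _)
  have h2 : ({u, y} : Multiset G) ≤ {u, v, y} + Y :=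
    le_trans ((Multiset.le_add_right _ {v}).trans_eq (by
      simp only [Multiset.insert_eq_cons, ← Multiset.singleton_add]; abel))
      (Multiset.le_add_right _ _)
  have h3 : ({v, y} : Multiset G) ≤ {u, v, y} + Y :=
    le_trans ((Multiset.le_add_right _ {u}).trans_eq (by
      simp only [Multiset.insert_eq_cons, ← Multiset.singleton_add]; abel))
      (Multiset.le_add_right _ _)
  have e1 := hP.block_sum_eq hR hS (IsBlock.of_pair hR huv) h1 (by simp)
    (IsBlock.of_pair hR hyu.symm) h2 (by simp)
  have e2 := hP.block_sum_eq hR hS (IsBlock.of_pair hR huv) h1 (by simp)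
    (IsBlock.of_pair hR (huv.symm.trans hyu.symm)) h3 (by simp)
  simp at e1 e2
  subst e1
  simp [add_right_cancel e2]

end ZeroSum

/-! ### The shape of a sequence of length `2n + 3` -/

namespace ZeroSum

variable {G V : Type*} [AddCommGroup G] [AddCommGroup V] {π : G →+ V} {n : ℕ}
variable {S W : Multiset G} {B : Multiset (Multiset G)}

/-- All nonempty subsums of `u, v, w` are nonzero; in an elementary `2`-group this is linear
independence. -/
structure Indep3 (u v w : V) : Prop where
  h₁ : u ≠ 0
  h₂ : v ≠ 0
  h₃ : w ≠ 0
  h₁₂ : u + v ≠ 0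
  h₁₃ : u + w ≠ 0
  h₂₃ : v + w ≠ 0
  h₁₂₃ : u + (v + w) ≠ 0

theorem exists_sum_eq_add_self {G : Type*} {B : Multiset (Multiset G)} {p : G → Prop} (hB : ∀ P ∈ B, ∃ s, P = {s, s} ∧ p s) :
    ∃ U : Multiset G, U.card = B.card ∧ B.sum = U + U ∧ ∀ s ∈ U, p s := by
  induction B using Multiset.induction with
  | empty => exact ⟨0, by simp⟩
  | cons P B ih =>
    obtain ⟨s, rfl, hs⟩ := hB P (Multiset.mem_cons_self _ _)
    obtain ⟨U, hc, hU, h⟩ := ih fun Q hQ => hB Q (Multiset.mem_cons_of_mem hQ)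
    refine ⟨s ::ₘ U, by simp [hc], ?_, by simpa [hs] using h⟩
    rw [Multiset.sum_cons, hU]
    simp only [Multiset.insert_eq_cons, ← Multiset.singleton_add]
    abel

/-- The sequence `S` consists of five elements `x, a, b, c, d` with `a + b = c + d = x`, all of odd
multiplicity; those of multiplicity greater than one have the same double `x + x`. -/
structure Shape (π : G →+ V) (n : ℕ) (S : Multiset G) (x a b c d : G) (U : Multiset G) : Prop where
  eq : S = {x, a, b, c, d} + (U + U)
  card : U.card + 1 = n
  mem : ∀ u ∈ U, u ∈ ({x, a, b, c, d} : Multiset G)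
  add_self : ∀ u ∈ U, u + u = x + x
  add₁ : a + b = x
  add₂ : c + d = x
  order : addOrderOf (x + x) = n
  indep : Indep3 (π x) (π a) (π c)

variable [Finite G]

theorem card_lt_of_not_hasShortZeroSum (hR : Reduction π n) (hS : ¬ HasShortZeroSum S) :
    S.card < 2 * n + 4 := by
  by_contra! hc
  have h2 := hR.two_le
  obtain ⟨B, W, hB, hk, rfl⟩ := exists_pairs hR.card_codomain π (n - 2) S (by omega)
  have hP : Peeled π n (B.sum + W) B W := ⟨hB, by omega, le_rfl⟩
  have := hP.card_lt hR hS
  rw [Multiset.card_add, card_sum_of_pair hB] at hc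
  omega

theorem exists_shape (hR : Reduction π n) (hS : ¬ HasShortZeroSum S) (hc : S.card = 2 * n + 3) :
    ∃ (x a b c d : G) (U : Multiset G), Shape π n S x a b c d U := by
  have h2 := hR.two_le
  obtain ⟨B, W, hB, hk, hBW⟩ := exists_pairs hR.card_codomain π (n - 2) S (by omega)
  have hP : Peeled π n S B W := ⟨hB, by omega, hBW.le⟩
  have hW : W.card = 7 := by
    rw [← hBW, Multiset.card_add, card_sum_of_pair hB] at hc
    omega
  have h0 := hP.zero_notMem hR hS hW.ge
  obtain ⟨u, v, Y, rfl, huv, hY, hY5⟩ := hP.exists_pair hR hS hW.ge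
  have h0Y : 0 ∉ Y.map π := fun h =>
    h0 (Multiset.mem_of_le (Multiset.map_le_map (Multiset.le_add_left _ _)) h)
  obtain ⟨x, a, b, c, d, rfl, hb, hd⟩ := exists_two_lines_of_map hR hY h0Y hY5
  have h2r := hR.add_self (π x)
  have h2a := hR.add_self (π a)
  have h2c := hR.add_self (π c)
  have hle₁ : ({x, a, b} : Multiset G) ≤ {x, a, b, c, d} :=
    (Multiset.le_add_right _ {c, d}).trans_eq (by
      simp only [Multiset.insert_eq_cons, ← Multiset.singleton_add]; abel)
  have hle₂ : ({x, c, d} : Multiset G) ≤ {x, a, b, c, d} :=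
    (Multiset.le_add_right _ {a, b}).trans_eq (by
      simp only [Multiset.insert_eq_cons, ← Multiset.singleton_add]; abel)
  have hle₃ : ({a, b, c, d} : Multiset G) ≤ {x, a, b, c, d} :=
    (Multiset.le_add_right _ {x}).trans_eq (by
      simp only [Multiset.insert_eq_cons, ← Multiset.singleton_add]; abel)
  have hb₁ : IsBlock π ({x, a, b} : Multiset G) := ⟨by simp, by simp; grind⟩
  have hb₂ : IsBlock π ({x, c, d} : Multiset G) := ⟨by simp, by simp; grind⟩
  have hb₃ : IsBlock π ({a, b, c, d} : Multiset G) := ⟨by simp, by simp; grind⟩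
  have hpair : ∀ (B' : Multiset (Multiset G)) (s t : G), π s = π t →
      Peeled π n S B' ({s, t} + {x, a, b, c, d}) →
      t = s ∧ s ∈ ({x, a, b, c, d} : Multiset G) ∧ s + s = x + (a + b) := by
    intro B' s t hst hP'
    obtain ⟨hs, rfl⟩ := hP'.pair_eq hR hS hst hY hY5
    have := hP'.block_sum_eq hR hS (X := {t, t}) (IsBlock.of_pair hR rfl)
      (Multiset.le_add_right _ _) (by simp) hb₁ (hle₁.trans (Multiset.le_add_left _ _)) (by simp)
    exact ⟨rfl, hs, by simpa using this⟩
  have e₁ := hP.block_sum_eq hR hS hb₁ (hle₁.trans (Multiset.le_add_left _ _)) (by simp)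
    hb₂ (hle₂.trans (Multiset.le_add_left _ _)) (by simp)
  have e₂ := hP.block_sum_eq hR hS hb₁ (hle₁.trans (Multiset.le_add_left _ _)) (by simp)
    hb₃ (hle₃.trans (Multiset.le_add_left _ _)) (by simp)
  have hord := hP.addOrderOf_block_sum hR hS hb₁ (hle₁.trans (Multiset.le_add_left _ _)) (by simp)
  simp only [Multiset.insert_eq_cons, Multiset.sum_cons, Multiset.sum_singleton] at e₁ e₂ hord
  have hcd : c + d = x := by linear_combination (norm := module) -e₂
  have hab : a + b = x := by linear_combination (norm := module) e₁ + hcd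
  rw [hab] at hord hpair
  obtain ⟨rfl, hu, huu⟩ := hpair B u v huv hP
  have hB' : ∀ P ∈ B, ∃ s, P = {s, s} ∧ s ∈ ({x, a, b, c, d} : Multiset G) ∧ s + s = x + x := by
    intro P hPB
    obtain ⟨s, t, rfl, hst⟩ := hB P hPB
    obtain ⟨B', rfl⟩ := Multiset.exists_cons_of_mem hPB
    -- Exchange: `{v, v}` replaces `{s, t}` among the peeled pairs, so what holds for the pair in
    -- `W` holds for every pair.
    have hP' : Peeled π n S ({v, v} ::ₘ B') ({s, t} + {x, a, b, c, d}) := by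
      refine ⟨?_, by simpa using hP.card, le_trans (le_of_eq ?_) hP.le⟩
      · simp only [Multiset.mem_cons, forall_eq_or_imp]
        exact ⟨⟨v, v, rfl, rfl⟩, fun Q hQ => hB Q (Multiset.mem_cons_of_mem hQ)⟩
      · simp only [Multiset.sum_cons]
        abel
    obtain ⟨rfl, h⟩ := hpair ({v, v} ::ₘ B') s t hst hP'
    exact ⟨t, rfl, h⟩
  obtain ⟨U, hU, hBU, hUp⟩ := exists_sum_eq_add_self hB'
  refine ⟨x, a, b, c, d, v ::ₘ U, ?_, ?_, ?_, ?_, hab, hcd, hord, ?_⟩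
  · rw [← hBW, hBU]
    simp only [Multiset.insert_eq_cons, ← Multiset.singleton_add]
    abel
  · rw [Multiset.card_cons, hU, hk]
    omega
  · rw [Multiset.forall_mem_cons]
    exact ⟨hu, fun s hs => (hUp s hs).1⟩
  · rw [Multiset.forall_mem_cons]
    exact ⟨huu, fun s hs => (hUp s hs).2⟩
  · simp [-Multiset.mem_map, ← hb, ← hd] at hY h0Y
    constructor <;> grind

theorem exists_eq_add_of_le_add {α : Type*} {T A B : Multiset α} (h : T ≤ A + B) :
    ∃ T₁ ≤ A, ∃ T₂ ≤ B, T = T₁ + T₂ := by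
  classical
  refine ⟨T ∩ A, Multiset.inter_le_right, T - A, ?_, ?_⟩
  · rwa [Multiset.sub_le_iff_le_add, add_comm]
  · ext x
    simp only [Multiset.count_add, Multiset.count_inter, Multiset.count_sub]
    omega

omit [Finite G]

theorem zmultiples_eq_ker (hR : Reduction π n) {g : G} (hg : addOrderOf g = n) (hπ : π g = 0) :
    AddSubgroup.zmultiples g = π.ker := by
  have hle : AddSubgroup.zmultiples g ≤ π.ker := by
    rwa [AddSubgroup.zmultiples_le]
  have : Finite π.ker := Nat.finite_of_card_ne_zero (by rw [hR.card_ker]; have := hR.two_le; omega)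
  exact AddSubgroup.eq_of_le_of_card_ge hle (by rw [Nat.card_zmultiples, hg, hR.card_ker])

theorem zsmul_eq_zero_or_self {v : V} (h : v + v = 0) (k : ℤ) : k • v = 0 ∨ k • v = v := by
  rcases Int.even_or_odd' k with ⟨m, rfl | rfl⟩
  · left
    rw [mul_comm, mul_smul, two_smul, h, smul_zero]
  · right
    rw [add_smul, mul_comm, mul_smul, two_smul, h, smul_zero, zero_add, one_smul]

/-- The kernel is generated by `f₃ + f₃`, so generation can be checked modulo 2. For independence,
reduction makes the coefficients of `f₁` and `f₂` even, which kills those terms and then the third.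
-/
theorem basis_of_indep3 (hR : Reduction π n) {f₁ f₂ f₃ : G} (h₁ : f₁ + f₁ = 0) (h₂ : f₂ + f₂ = 0)
    (h₃ : addOrderOf (f₃ + f₃) = n) (hi : Indep3 (π f₁) (π f₂) (π f₃)) :
    IsBasis ![f₁, f₂, f₃] ∧ addOrderOf f₁ = 2 ∧ addOrderOf f₂ = 2 ∧ addOrderOf f₃ = 2 * n := by
  have hne : ∀ f : G, π f ≠ 0 → f ≠ 0 := by
    rintro f hf rfl
    exact hf (map_zero π)
  have hker : ∀ z, π z = 0 → z ∈ AddSubgroup.zmultiples (f₃ + f₃) := by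
    intro z hz
    rw [zmultiples_eq_ker hR h₃ (by rw [map_add, hR.add_self])]
    exact hz
  have hzs : ∀ (k : ℤ) (f : G), k • π f = 0 ∨ k • π f = π f := fun k f =>
    zsmul_eq_zero_or_self (hR.add_self _) k
  have hzero : ∀ (k : ℤ) (f : G), f + f = 0 → k • π f = 0 → π f ≠ 0 → k • f = 0 := by
    intro k f hf hk hne
    rcases Int.even_or_odd' k with ⟨m, rfl | rfl⟩
    · rw [mul_comm, mul_smul, two_smul, hf, smul_zero]
    · rw [add_smul, mul_comm, mul_smul, two_smul, hR.add_self, smul_zero, zero_add, one_smul] at hk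
      exact (hne hk).elim
  refine ⟨⟨?_, ?_⟩, ?_, ?_, ?_⟩
  · intro k hk
    simp only [Fin.sum_univ_three, Matrix.cons_val] at hk
    have hπ := congrArg π hk
    simp only [map_add, map_zsmul, map_zero] at hπ
    have : k 0 • π f₁ = 0 ∧ k 1 • π f₂ = 0 := by
      obtain ⟨i1, i2, i3, i4, i5, i6, i7⟩ := hi
      rcases hzs (k 0) f₁ with e | e <;> rcases hzs (k 1) f₂ with e' | e' <;>
        rcases hzs (k 2) f₃ with e'' | e'' <;> rw [e, e', e''] at hπ <;> simp_all [add_assoc]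
    have hk1 := hzero _ _ h₁ this.1 hi.h₁
    have hk2 := hzero _ _ h₂ this.2 hi.h₂
    rw [hk1, hk2, zero_add, zero_add] at hk
    intro i
    fin_cases i
    exacts [hk1, hk2, hk]
  · rw [eq_top_iff]
    intro z _
    set H := AddSubgroup.closure (Set.range ![f₁, f₂, f₃]) with hH
    have m₁ : f₁ ∈ H := AddSubgroup.subset_closure ⟨0, rfl⟩
    have m₂ : f₂ ∈ H := AddSubgroup.subset_closure ⟨1, rfl⟩
    have m₃ : f₃ ∈ H := AddSubgroup.subset_closure ⟨2, rfl⟩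
    have hmem : ∀ w ∈ H, π z = π w → z ∈ H := by
      intro w hw h
      have : z - w ∈ AddSubgroup.zmultiples (f₃ + f₃) := hker _ (by rw [map_sub, h, sub_self])
      have := (AddSubgroup.zmultiples_le.2 (H.add_mem m₃ m₃)) this
      simpa using H.add_mem this hw
    have t1 := hR.add_self (π f₁)
    have t2 := hR.add_self (π f₂)
    have t3 := hR.add_self (π f₃)
    obtain ⟨i1, i2, i3, i4, i5, i6, i7⟩ := hi
    rcases eq_of_independent_of_card_eight hR.add_self hR.card_codomain (r := π f₁) (a := π f₂)
      (c := π f₃) (by grind) (by grind) (by grind) (by grind) (by grind) (by grind) (by grind)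
      (π z) with h | h | h | h | h | h | h | h
    · exact hmem 0 H.zero_mem (by simpa using h)
    · exact hmem f₁ m₁ h
    · exact hmem f₂ m₂ h
    · exact hmem (f₁ + f₂) (H.add_mem m₁ m₂) (by simpa using h)
    · exact hmem f₃ m₃ h
    · exact hmem (f₁ + f₃) (H.add_mem m₁ m₃) (by simpa using h)
    · exact hmem (f₂ + f₃) (H.add_mem m₂ m₃) (by simpa using h)
    · exact hmem (f₁ + (f₂ + f₃)) (H.add_mem m₁ (H.add_mem m₂ m₃)) (by simpa using h)
  · exact addOrderOf_eq_prime (by rw [two_nsmul, h₁]) (hne _ hi.h₁)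
  · exact addOrderOf_eq_prime (by rw [two_nsmul, h₂]) (hne _ hi.h₂)
  · have hn := hR.two_le
    rw [← two_nsmul] at h₃
    rcases Nat.even_or_odd (addOrderOf f₃) with he | ho
    · rw [addOrderOf_nsmul' f₃ two_ne_zero, Nat.gcd_eq_right he.two_dvd] at h₃
      have := he.two_dvd
      omega
    -- An odd order would put `f₃` into the kernel of `π`.
    · exfalso
      refine hi.h₃ ?_
      obtain ⟨m, hm⟩ := ho
      have h0 : (2 * m + 1) • f₃ = 0 := by rw [← hm, addOrderOf_nsmul_eq_zero]
      have := congrArg π h0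
      rw [map_nsmul, add_smul, mul_comm, mul_smul, two_smul, hR.add_self] at this
      simpa using this

end ZeroSum

/-! ### From the shape to the three forms -/

namespace ZeroSum

variable {G V : Type*} [AddCommGroup G] [AddCommGroup V] {π : G →+ V} {n : ℕ}
variable {S U : Multiset G} {x a b c d : G}

theorem sub_eq_add_of_add_self (h : ∀ v : V, v + v = 0) (u v : V) : u - v = u + v := by
  rw [sub_eq_iff_eq_add, add_assoc, h, add_zero]

theorem Shape.swap (hR : Reduction π n) (h : Shape π n S x a b c d U) :
    Shape π n S x b a c d U := by
  have e : ({x, a, b, c, d} : Multiset G) = {x, b, a, c, d} := by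
    simp only [Multiset.insert_eq_cons, ← Multiset.singleton_add]; abel
  refine ⟨e ▸ h.eq, h.card, e ▸ h.mem, h.add_self, (add_comm _ _).trans h.add₁, h.add₂, h.order, ?_⟩
  have h₁ := congrArg π h.add₁
  rw [map_add] at h₁
  have := hR.add_self (π a)
  have := hR.add_self (π b)
  obtain ⟨i₁, i₂, i₃, i₄, i₅, i₆, i₇⟩ := h.indep
  constructor <;> grind

theorem Shape.swap_pairs (h : Shape π n S x a b c d U) :
    Shape π n S x c d a b U := by
  have e : ({x, a, b, c, d} : Multiset G) = {x, c, d, a, b} := by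
    simp only [Multiset.insert_eq_cons, ← Multiset.singleton_add]; abel
  refine ⟨e ▸ h.eq, h.card, e ▸ h.mem, h.add_self, h.add₂, h.add₁, h.order, ?_⟩
  obtain ⟨i₁, i₂, i₃, i₄, i₅, i₆, i₇⟩ := h.indep
  constructor <;> grind

theorem Shape.double_ne_zero (hR : Reduction π n) (h : Shape π n S x a b c d U) : x + x ≠ 0 := by
  intro h0
  have h1 := h.order
  have := hR.two_le
  rw [h0, addOrderOf_zero] at h1
  omega

/-- An element whose double is neither `y + y` nor zero is the sum of a multiple of `y` and an
element of order at most two. -/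
theorem exists_coeff (hR : Reduction π n) {y z : G} (hy : addOrderOf (y + y) = n)
    (h1 : z + z ≠ y + y) (h0 : z + z ≠ 0) :
    ∃ k : ℤ, 2 ≤ k ∧ k ≤ (n : ℤ) - 1 ∧ z + z = k • (y + y) := by
  have hπ : ∀ w, π (w + w) = 0 := fun w => by rw [map_add, hR.add_self]
  have hz : z + z ∈ AddSubgroup.zmultiples (y + y) := by
    rw [zmultiples_eq_ker hR hy (hπ y)]
    exact hπ z
  obtain ⟨k, hk⟩ := AddSubgroup.mem_zmultiples_iff.1 hz
  have hn := hR.two_le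
  have hmod : (k % (n : ℤ)) • (y + y) = z + z := by
    rw [← hk, ← hy, mod_addOrderOf_zsmul]
  have hlt := Int.emod_lt_of_pos k (b := (n : ℤ)) (by omega)
  have hge := Int.emod_nonneg k (b := (n : ℤ)) (by omega)
  refine ⟨k % n, ?_, by omega, hmod.symm⟩
  by_contra! hlt2
  obtain e | e : k % (n : ℤ) = 0 ∨ k % (n : ℤ) = 1 := by omega
  · rw [e, zero_smul] at hmod
    exact h0 hmod.symm
  · rw [e, one_smul] at hmod
    exact h1 hmod.symm

theorem exists_replicate_add_replicate {α : Type*} {U : Multiset α} {p q : α}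
    (h : ∀ u ∈ U, u = p ∨ u = q) :
    ∃ i j, i + j = U.card ∧ U = Multiset.replicate i p + Multiset.replicate j q := by
  induction U using Multiset.induction with
  | empty => exact ⟨0, 0, by simp⟩
  | cons u U ih =>
    rw [Multiset.forall_mem_cons] at h
    obtain ⟨i, j, hij, hU⟩ := ih h.2
    rcases h.1 with rfl | rfl
    · refine ⟨i + 1, j, by rw [Multiset.card_cons]; omega, ?_⟩
      rw [Multiset.replicate_succ, Multiset.cons_add, ← hU]
    · refine ⟨i, j + 1, by rw [Multiset.card_cons]; omega, ?_⟩
      rw [Multiset.replicate_succ, Multiset.add_cons, ← hU]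

/-- There is a basis with orders `2, 2, 2 * n` with respect to which `S` has one of the three
extremal forms. -/
def HasExtremalForm (n : ℕ) (S : Multiset G) : Prop :=
  ∃ f₁ f₂ f₃ : G, IsBasis ![f₁, f₂, f₃] ∧
    addOrderOf f₁ = 2 ∧ addOrderOf f₂ = 2 ∧ addOrderOf f₃ = 2 * n ∧
    (FormEta1 n f₁ f₂ f₃ S ∨ FormEta2 n f₁ f₂ f₃ S ∨ FormEta3 n f₁ f₂ f₃ S)

theorem Shape.hasExtremalForm_of_eq_of_eq (hR : Reduction π n) (h : Shape π n S x a b c d U)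
    (ha : a + a = x + x) (hc : c + c = x + x) : HasExtremalForm n S := by
  have hx0 := h.double_ne_zero hR
  have hab := h.add₁
  have hcd := h.add₂
  have hb : b + b = 0 := by linear_combination (norm := module) hab + hab - ha
  have hd : d + d = 0 := by linear_combination (norm := module) hcd + hcd - hc
  have ha' : a = x + b := by linear_combination (norm := module) hab - hb
  have hc' : c = x + d := by linear_combination (norm := module) hcd - hd
  have hi : Indep3 (π b) (π d) (π x) := by
    obtain ⟨i₁, i₂, i₃, i₄, i₅, i₆, i₇⟩ := h.indep
    rw [ha', hc'] at *
    simp only [map_add] at *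
    have := hR.add_self (π x)
    constructor <;> grind
  obtain ⟨hB, o₁, o₂, o₃⟩ := basis_of_indep3 hR hb hd h.order hi
  have hU : ∀ u ∈ U, u = x ∨ u = x + b ∨ u = x + d := by
    intro u hu
    have h1 := h.mem u hu
    have h2 := h.add_self u hu
    rw [ha', hc'] at h1
    simp only [Multiset.insert_eq_cons, Multiset.mem_cons, Multiset.mem_singleton] at h1
    rcases h1 with rfl | rfl | rfl | rfl | rfl
    · exact Or.inl rfl
    · exact Or.inr (Or.inl rfl)
    · exact (hx0 (h2.symm.trans hb)).elim
    · exact Or.inr (Or.inr rfl)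
    · exact (hx0 (h2.symm.trans hd)).elim
  have hmem : ∀ e ∈ (U + U + {x, x + b, x + d}).map (· - x), e = 0 ∨ e = b ∨ e = d := by
    intro e he
    obtain ⟨u, hu, rfl⟩ := Multiset.mem_map.1 he
    have hu' : u = x ∨ u = x + b ∨ u = x + d := by
      simp only [Multiset.mem_add, or_self, Multiset.insert_eq_cons, Multiset.mem_cons,
        Multiset.mem_singleton] at hu
      exact hu.elim (hU u) id
    rcases hu' with rfl | rfl | rfl <;> simp
  -- The doubled part cancels because `2u = 2x` on `U`; the sum `b + d` is then outside the support,
  -- which lies in `{0, b, d}`.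
  have hsum : ((U + U + {x, x + b, x + d}).map (· - x)).sum = b + d := by
    have h0 : (U.map (· - x) + U.map (· - x)).sum = 0 := by
      rw [Multiset.sum_add, ← Multiset.sum_map_add]
      refine Multiset.sum_eq_zero fun e he => ?_
      obtain ⟨u, hu, rfl⟩ := Multiset.mem_map.1 he
      linear_combination (norm := module) h.add_self u hu
    rw [Multiset.map_add, Multiset.map_add, Multiset.sum_add, h0]
    simp
  refine ⟨b, d, x, hB, o₁, o₂, o₃, Or.inr (Or.inr
    ⟨(U + U + {x, x + b, x + d}).map (· - x), ?_, ?_, ?_, ?_⟩)⟩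
  · have := h.card
    simp
    omega
  · intro e he
    rcases hmem e he with rfl | rfl | rfl
    · exact zero_mem _
    · exact AddSubgroup.subset_closure (by simp)
    · exact AddSubgroup.subset_closure (by simp)
  · rw [hsum]
    intro he
    obtain ⟨i₁, i₂, i₃, i₄, i₅, i₆, i₇⟩ := hi
    rcases hmem _ he with e | e | e
    · exact i₄ (by rw [← map_add, e, map_zero])
    · exact i₂ (by rw [add_eq_left.1 e, map_zero])
    · exact i₁ (by rw [add_eq_right.1 e, map_zero])
  · rw [h.eq, Multiset.map_map]
    simp only [Function.comp_def, add_sub_cancel, Multiset.map_id']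
    rw [← ha', ← hc']
    simp only [Multiset.insert_eq_cons, ← Multiset.singleton_add]
    abel

theorem Shape.hasExtremalForm_of_eq_of_ne (hR : Reduction π n) (h : Shape π n S x a b c d U)
    (ha : a + a = x + x) (hc : c + c ≠ x + x) (hd : d + d ≠ x + x) : HasExtremalForm n S := by
  have hx0 := h.double_ne_zero hR
  have hab := h.add₁
  have hcd := h.add₂
  have hb : b + b = 0 := by linear_combination (norm := module) hab + hab - ha
  have hc0 : c + c ≠ 0 := by
    intro h0
    exact hd (by linear_combination (norm := module) hcd + hcd - h0)
  have hoa : addOrderOf (a + a) = n := by rw [ha, h.order]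
  obtain ⟨k, hk2, hkn, hk⟩ := exists_coeff hR hoa (ha ▸ hc) hc0
  have hf : (c - k • a) + (c - k • a) = 0 := by
    linear_combination (norm := module) hk
  have hi : Indep3 (π (c - k • a)) (π b) (π a) := by
    obtain ⟨i₁, i₂, i₃, i₄, i₅, i₆, i₇⟩ := h.indep
    have h₁ := congrArg π hab
    rw [map_add] at h₁
    have := hR.add_self (π a)
    rw [map_sub, map_zsmul, sub_eq_add_of_add_self hR.add_self]
    rcases zsmul_eq_zero_or_self this k with e | e <;> rw [e] <;> constructor <;> grind
  obtain ⟨hB, o₁, o₂, o₃⟩ := basis_of_indep3 hR hf hb hoa hi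
  have hU : ∀ u ∈ U, u = a ∨ u = x := by
    intro u hu
    have h1 := h.mem u hu
    have h2 := h.add_self u hu
    simp only [Multiset.insert_eq_cons, Multiset.mem_cons, Multiset.mem_singleton] at h1
    rcases h1 with rfl | rfl | rfl | rfl | rfl
    · exact Or.inr rfl
    · exact Or.inl rfl
    · exact (hx0 (h2.symm.trans hb)).elim
    · exact (hc h2).elim
    · exact (hd h2).elim
  obtain ⟨i, j, hij, hUij⟩ := exists_replicate_add_replicate hU
  have hn := h.card
  -- Here `f₃ = a` and `x = f₃ + f₂`, so `v` is the multiplicity `j` of `x` in `U`.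
  refine ⟨c - k • a, b, a, hB, o₁, o₂, o₃, Or.inl ⟨j, k, by omega, hk2, hkn, ?_⟩⟩
  have e₁ : 2 * n - 1 - 2 * j = i + i + 1 := by omega
  have e₂ : k • a + (c - k • a) = c := by abel
  have e₃ : (1 - k) • a + b + (c - k • a) = d := by
    linear_combination (norm := module) hab - hcd + hk
  rw [h.eq, hUij, e₁, e₂, e₃, hab, two_mul]
  simp only [Multiset.replicate_add, Multiset.replicate_one, Multiset.insert_eq_cons,
    ← Multiset.singleton_add]
  abel

theorem Shape.hasExtremalForm_of_ne (hR : Reduction π n) (h : Shape π n S x a b c d U)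
    (ha : a + a ≠ x + x) (hb : b + b ≠ x + x) (hc : c + c ≠ x + x) (hd : d + d ≠ x + x) :
    HasExtremalForm n S := by
  have hab := h.add₁
  have hcd := h.add₂
  have ha0 : a + a ≠ 0 := by
    intro h0
    exact hb (by linear_combination (norm := module) hab + hab - h0)
  have hc0 : c + c ≠ 0 := by
    intro h0
    exact hd (by linear_combination (norm := module) hcd + hcd - h0)
  have hU : U = Multiset.replicate U.card x := by
    refine Multiset.eq_replicate.2 ⟨rfl, fun u hu => ?_⟩
    have h1 := h.mem u hu
    have h2 := h.add_self u hu
    simp only [Multiset.insert_eq_cons, Multiset.mem_cons, Multiset.mem_singleton] at h1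
    rcases h1 with rfl | rfl | rfl | rfl | rfl
    · rfl
    all_goals contradiction
  obtain ⟨k, hk2, hkn, hk⟩ := exists_coeff hR h.order ha ha0
  obtain ⟨l, hl2, hln, hl⟩ := exists_coeff hR h.order hc hc0
  -- Stated for arbitrary pairs so that exchanging them yields the ordering `b ≤ a` of the
  -- parameters.
  have key : ∀ {a b c d : G} {k l : ℤ}, Shape π n S x a b c d U → 2 ≤ k → k ≤ (n : ℤ) - 1 →
      2 ≤ l → l ≤ (n : ℤ) - 1 → a + a = k • (x + x) → c + c = l • (x + x) → l ≤ k →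
      HasExtremalForm n S := by
    clear * - hR hU
    intro a b c d k l h hk2 hkn hl2 hln hk hl hlk
    have hab := h.add₁
    have hcd := h.add₂
    have hf₂ : (a - k • x) + (a - k • x) = 0 := by
      linear_combination (norm := module) hk
    have hf₁ : (c - l • x) + (c - l • x) = 0 := by
      linear_combination (norm := module) hl
    have hi : Indep3 (π (c - l • x)) (π (a - k • x)) (π x) := by
      obtain ⟨i₁, i₂, i₃, i₄, i₅, i₆, i₇⟩ := h.indep
      have := hR.add_self (π x)
      rw [map_sub, map_zsmul, map_sub, map_zsmul, sub_eq_add_of_add_self hR.add_self,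
        sub_eq_add_of_add_self hR.add_self]
      rcases zsmul_eq_zero_or_self this k with e | e <;>
        rcases zsmul_eq_zero_or_self this l with e' | e' <;> rw [e, e'] <;> constructor <;> grind
    obtain ⟨hB, o₁, o₂, o₃⟩ := basis_of_indep3 hR hf₁ hf₂ h.order hi
    refine ⟨c - l • x, a - k • x, x, hB, o₁, o₂, o₃,
      Or.inr (Or.inl ⟨k, l, hk2, hkn, hl2, hln, hlk, ?_⟩)⟩
    have e₁ : 2 * n - 1 = U.card + U.card + 1 := by have := h.card; omega
    have e₂ : k • x + (a - k • x) = a := by abel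
    have e₃ : (1 - k) • x + (a - k • x) = b := by
      linear_combination (norm := module) hk - hab
    have e₄ : l • x + (c - l • x) = c := by abel
    have e₅ : (1 - l) • x + (c - l • x) = d := by
      linear_combination (norm := module) hl - hcd
    rw [h.eq, e₁, e₂, e₃, e₄, e₅, Multiset.replicate_add, Multiset.replicate_add, ← hU]
    simp only [Multiset.replicate_one, Multiset.insert_eq_cons, ← Multiset.singleton_add]
    abel
  rcases le_total l k with hlk | hkl
  · exact key h hk2 hkn hl2 hln hk hl hlk
  · exact key (h.swap_pairs) hl2 hln hk2 hkn hl hk hkl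

theorem Shape.hasExtremalForm (hR : Reduction π n) (h : Shape π n S x a b c d U) :
    HasExtremalForm n S := by
  by_cases hab : a + a = x + x ∨ b + b = x + x
  · wlog ha : a + a = x + x generalizing a b
    · exact this (h.swap hR) hab.symm (hab.resolve_left ha)
    by_cases hc : c + c = x + x
    · exact h.hasExtremalForm_of_eq_of_eq hR ha hc
    by_cases hd : d + d = x + x
    · exact ((((h.swap_pairs).swap hR).swap_pairs)).hasExtremalForm_of_eq_of_eq hR ha hd
    exact h.hasExtremalForm_of_eq_of_ne hR ha hc hd
  · rw [not_or] at hab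
    by_cases hcd : c + c = x + x ∨ d + d = x + x
    · wlog hc : c + c = x + x generalizing c d
      · exact this ((((h.swap_pairs).swap hR).swap_pairs)) hcd.symm (hcd.resolve_left hc)
      exact (h.swap_pairs).hasExtremalForm_of_eq_of_ne hR hc hab.1 hab.2
    · rw [not_or] at hcd
      exact h.hasExtremalForm_of_ne hR hab.1 hab.2 hcd.1 hcd.2

end ZeroSum

/-! ### The converse and the lower bound for `η` -/

namespace ZeroSum

variable {G V : Type*} [AddCommGroup G] [AddCommGroup V] {π : G →+ V} {n : ℕ}
variable {S : Multiset G} {f₁ f₂ f₃ : G}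

theorem Independent.dvd (hB : Independent ![f₁, f₂, f₃]) (k₁ k₂ k₃ : ℤ)
    (h : k₁ • f₁ + k₂ • f₂ + k₃ • f₃ = 0) :
    (addOrderOf f₁ : ℤ) ∣ k₁ ∧ (addOrderOf f₂ : ℤ) ∣ k₂ ∧ (addOrderOf f₃ : ℤ) ∣ k₃ := by
  have := hB ![k₁, k₂, k₃] (by simpa [Fin.sum_univ_three] using h)
  simp only [addOrderOf_dvd_iff_zsmul_eq_zero]
  exact ⟨this 0, this 1, this 2⟩

theorem exists_of_le_cons {α : Type*} {T A : Multiset α} {a : α} (h : T ≤ a ::ₘ A) :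
    ∃ e ≤ 1, ∃ T' ≤ A, T = Multiset.replicate e a + T' := by
  by_cases ha : a ∈ T
  · obtain ⟨T', rfl⟩ := Multiset.exists_cons_of_mem ha
    exact ⟨1, le_rfl, T', (Multiset.cons_le_cons_iff _).1 h, by simp⟩
  · exact ⟨0, zero_le_one, T, (Multiset.le_cons_of_notMem ha).1 h, by simp⟩

theorem exists_of_le_singleton {α : Type*} {T : Multiset α} {a : α} (h : T ≤ {a}) :
    ∃ e ≤ 1, T = Multiset.replicate e a := by
  obtain ⟨e, he, T', hT', rfl⟩ := exists_of_le_cons (A := 0) (a := a) (by simpa using h)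
  exact ⟨e, he, by rw [Multiset.le_zero.1 hT', add_zero]⟩

theorem FormEta1.not_hasShortZeroSum (hexp : AddMonoid.exponent G = 2 * n) (hn : 2 ≤ n)
    (hB : Independent ![f₁, f₂, f₃]) (o₁ : addOrderOf f₁ = 2) (o₂ : addOrderOf f₂ = 2)
    (o₃ : addOrderOf f₃ = 2 * n) (h : FormEta1 n f₁ f₂ f₃ S) : ¬ HasShortZeroSum S := by
  obtain ⟨v, a, hv, -, -, rfl⟩ := h
  rintro ⟨T, hT, hT0, hTc, hTs⟩
  obtain ⟨T₁, hT₁, T₂, hT₂, rfl⟩ := exists_eq_add_of_le_add hT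
  obtain ⟨T₃, hT₃, T₄, hT₄, rfl⟩ := exists_eq_add_of_le_add hT₁
  obtain ⟨i, hi, rfl⟩ := Multiset.le_replicate_iff.1 hT₃
  obtain ⟨j, hj, rfl⟩ := Multiset.le_replicate_iff.1 hT₄
  obtain ⟨e₁, he₁, R₁, hR₁, rfl⟩ := exists_of_le_cons hT₂
  obtain ⟨e₂, he₂, R₂, hR₂, rfl⟩ := exists_of_le_cons hR₁
  obtain ⟨e₃, he₃, rfl⟩ := exists_of_le_singleton hR₂
  rw [← Multiset.card_pos] at hT0
  simp only [Multiset.card_add, Multiset.card_replicate, Multiset.sum_add,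
    Multiset.sum_replicate] at hT0 hTc hTs
  rw [hexp] at hTc
  obtain ⟨d₁, d₂, d₃⟩ := hB.dvd (e₂ + e₃) (j + e₁ + e₃) (i + j + e₂ * a + e₃ * (1 - a)) (by
    rw [← hTs]; module)
  rw [o₁] at d₁
  rw [o₂] at d₂
  rw [o₃] at d₃
  have he : e₂ = e₃ := by omega
  subst he
  have d₃' : 2 * n ∣ i + j + e₂ := by
    zify
    convert d₃ using 1
    · push_cast; ring
    · ring
  -- If positive, the length bound forces `i + j = 2 * n` and `e₁ = e₂ = 0`. Then `j = 2 * v + 1` is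
  -- odd, against the parity at `f₂`.
  rcases Nat.eq_zero_or_pos (i + j + e₂) with h0 | h0
  · omega
  · have := Nat.le_of_dvd h0 d₃'
    omega

theorem FormEta2.not_hasShortZeroSum (hexp : AddMonoid.exponent G = 2 * n) (hn : 2 ≤ n)
    (hB : Independent ![f₁, f₂, f₃]) (o₁ : addOrderOf f₁ = 2) (o₂ : addOrderOf f₂ = 2)
    (o₃ : addOrderOf f₃ = 2 * n) (h : FormEta2 n f₁ f₂ f₃ S) : ¬ HasShortZeroSum S := by
  obtain ⟨a, b, -, -, -, -, -, rfl⟩ := h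
  rintro ⟨T, hT, hT0, hTc, hTs⟩
  obtain ⟨T₁, hT₁, T₂, hT₂, rfl⟩ := exists_eq_add_of_le_add hT
  obtain ⟨i, hi, rfl⟩ := Multiset.le_replicate_iff.1 hT₁
  obtain ⟨e₁, he₁, R₁, hR₁, rfl⟩ := exists_of_le_cons hT₂
  obtain ⟨e₂, he₂, R₂, hR₂, rfl⟩ := exists_of_le_cons hR₁
  obtain ⟨e₃, he₃, R₃, hR₃, rfl⟩ := exists_of_le_cons hR₂
  obtain ⟨e₄, he₄, rfl⟩ := exists_of_le_singleton hR₃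
  rw [← Multiset.card_pos] at hT0
  simp only [Multiset.card_add, Multiset.card_replicate, Multiset.sum_add,
    Multiset.sum_replicate] at hT0 hTc hTs
  rw [hexp] at hTc
  obtain ⟨d₁, d₂, d₃⟩ := hB.dvd (e₃ + e₄) (e₁ + e₂)
    (i + e₁ * a + e₂ * (1 - a) + e₃ * b + e₄ * (1 - b)) (by rw [← hTs]; module)
  rw [o₁] at d₁
  rw [o₂] at d₂
  rw [o₃] at d₃
  have he : e₁ = e₂ := by omega
  have he' : e₃ = e₄ := by omega
  subst he he'
  have d₃' : 2 * n ∣ i + e₁ + e₃ := by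
    zify
    convert d₃ using 1
    · push_cast; ring
    · ring
  -- If positive, it is at least `2 * n` while `i ≤ 2 * n - 1`, so `e₁ + e₃ ≥ 1` and the length `i +
  -- 2 * e₁ + 2 * e₃` exceeds `2 * n`.
  rcases Nat.eq_zero_or_pos (i + e₁ + e₃) with h0 | h0
  · omega
  · have := Nat.le_of_dvd h0 d₃'
    omega

theorem FormEta3.not_hasShortZeroSum (hexp : AddMonoid.exponent G = 2 * n)
    (hB : Independent ![f₁, f₂, f₃]) (o₁ : addOrderOf f₁ = 2) (o₂ : addOrderOf f₂ = 2)
    (o₃ : addOrderOf f₃ = 2 * n) (h : FormEta3 n f₁ f₂ f₃ S) : ¬ HasShortZeroSum S := by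
  obtain ⟨S', hc, hcl, hsum, rfl⟩ := h
  rintro ⟨T, hT, hT0, hTc, hTs⟩
  obtain ⟨T₁, hT₁, T₂, hT₂, rfl⟩ := exists_eq_add_of_le_add hT
  obtain ⟨D, hD, rfl⟩ := exists_le_of_le_map _ hT₁
  obtain ⟨e₁, he₁, R₁, hR₁, rfl⟩ := exists_of_le_cons hT₂
  obtain ⟨e₂, he₂, rfl⟩ := exists_of_le_singleton hR₁
  have hDcl : D.sum ∈ AddSubgroup.closure {f₁, f₂} :=
    AddSubgroup.multiset_sum_mem _ D fun d hd => hcl d (Multiset.mem_of_le hD hd)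
  obtain ⟨p, q, hpq⟩ := AddSubgroup.mem_closure_pair.1 hDcl
  have hDsum : (D.map (fun d => f₃ + d)).sum = D.card • f₃ + D.sum := by
    rw [Multiset.sum_map_add (f := fun _ => f₃) (g := fun d => d)]
    simp
  rw [← Multiset.card_pos] at hT0
  simp only [Multiset.card_add, Multiset.card_replicate, Multiset.sum_add, Multiset.card_map,
    Multiset.sum_replicate, hDsum] at hT0 hTc hTs
  rw [hexp] at hTc
  obtain ⟨d₁, d₂, d₃⟩ := hB.dvd (p + e₂) (q + e₁) D.card (by rw [← hTs, ← hpq]; module)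
  rw [o₁] at d₁
  rw [o₂] at d₂
  rw [o₃] at d₃
  have d₃' : 2 * n ∣ D.card := by exact_mod_cast d₃
  rcases Nat.eq_zero_or_pos D.card with h0 | h0
  · rw [Multiset.card_eq_zero.1 h0, Multiset.sum_zero] at hpq
    obtain ⟨d₁', d₂', -⟩ := hB.dvd p q 0 (by rw [hpq]; simp)
    rw [o₁] at d₁'
    rw [o₂] at d₂'
    omega
  · have hle := Nat.le_of_dvd h0 d₃'
    have hD2 : D.card = 2 * n := by omega
    have he₁' : e₁ = 0 := by omega
    have he₂' : e₂ = 0 := by omega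
    rw [hD2, ← o₃, addOrderOf_nsmul_eq_zero, he₁', he₂'] at hTs
    have hD0 : D.sum = 0 := by simpa using hTs
    -- As `D` has sum zero and omits a single term of `S'`, that term equals the sum of `S'`.
    obtain ⟨E, rfl⟩ := Multiset.le_iff_exists_add.1 hD
    obtain ⟨d, rfl⟩ : ∃ d, E = {d} := Multiset.card_eq_one.1 (by
      rw [Multiset.card_add] at hc
      omega)
    refine hsum ?_
    rw [Multiset.sum_add, hD0]
    simp

theorem HasExtremalForm.not_hasShortZeroSum (hexp : AddMonoid.exponent G = 2 * n) (hn : 2 ≤ n)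
    (h : HasExtremalForm n S) : ¬ HasShortZeroSum S := by
  obtain ⟨f₁, f₂, f₃, ⟨hB, -⟩, o₁, o₂, o₃, h | h | h⟩ := h
  · exact h.not_hasShortZeroSum hexp hn hB o₁ o₂ o₃
  · exact h.not_hasShortZeroSum hexp hn hB o₁ o₂ o₃
  · exact h.not_hasShortZeroSum hexp hB o₁ o₂ o₃

/-- Form (η3) serves for every `n ≥ 2`; the parameter ranges of the other two are empty for `n = 2`.
-/
theorem Reduction.exists_hasExtremalForm (hR : Reduction π n) (h₁ : f₁ + f₁ = 0)
    (h₂ : f₂ + f₂ = 0) (h₃ : addOrderOf (f₃ + f₃) = n) (hi : Indep3 (π f₁) (π f₂) (π f₃)) :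
    ∃ S : Multiset G, S.card = 2 * n + 3 ∧ HasExtremalForm n S := by
  obtain ⟨hB, o₁, o₂, o₃⟩ := basis_of_indep3 hR h₁ h₂ h₃ hi
  have hn := hR.two_le
  set S' : Multiset G := Multiset.replicate (2 * n - 1) 0 + {f₁, f₂} with hS'
  have hc : S'.card = 2 * n + 1 := by
    simp [hS']
    omega
  have hmem : ∀ e ∈ S', e = 0 ∨ e = f₁ ∨ e = f₂ := by
    intro e he
    rw [hS', Multiset.mem_add, Multiset.mem_replicate] at he
    simp only [Multiset.insert_eq_cons, Multiset.mem_cons, Multiset.mem_singleton] at he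
    tauto
  refine ⟨S'.map (fun d => f₃ + d) + {f₂, f₁}, by simp [hc], f₁, f₂, f₃, hB, o₁, o₂, o₃,
    Or.inr (Or.inr ⟨S', hc, ?_, ?_, rfl⟩)⟩
  · intro e he
    rcases hmem e he with rfl | rfl | rfl
    · exact zero_mem _
    · exact AddSubgroup.subset_closure (by simp)
    · exact AddSubgroup.subset_closure (by simp)
  · have hsum : S'.sum = f₁ + f₂ := by simp [hS']
    rw [hsum]
    intro he
    rcases hmem _ he with e | e | e
    · exact hi.h₁₂ (by rw [← map_add, e, map_zero])
    · exact hi.h₂ (by rw [add_eq_left.1 e, map_zero])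
    · exact hi.h₁ (by rw [add_eq_right.1 e, map_zero])

/-- Reduction modulo `2` on `C₂ ⊕ C₂ ⊕ C₂ₙ`. -/
def reduceModTwo (n : ℕ) : ZMod 2 × ZMod 2 × ZMod (2 * n) →+ ZMod 2 × ZMod 2 × ZMod 2 :=
  (AddMonoidHom.id _).prodMap ((AddMonoidHom.id _).prodMap
    (ZMod.castHom (dvd_mul_right 2 n) (ZMod 2)).toAddMonoidHom)

theorem reduction_of_equiv (hn : 2 ≤ n) (e : G ≃+ ZMod 2 × ZMod 2 × ZMod (2 * n)) :
    Reduction ((reduceModTwo n).comp e.toAddMonoidHom) n := by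
  have : NeZero (2 * n) := ⟨by omega⟩
  have hsurj : Function.Surjective ((reduceModTwo n).comp e.toAddMonoidHom) := by
    refine Function.Surjective.comp (g := reduceModTwo n) ?_ e.surjective
    rintro ⟨x, y, z⟩
    obtain ⟨z', rfl⟩ := ZMod.castHom_surjective (dvd_mul_right 2 n) z
    exact ⟨(x, y, z'), rfl⟩
  have hV : Nat.card (ZMod 2 × ZMod 2 × ZMod 2) = 8 := by simp
  have hG : Nat.card G = 2 * (2 * (2 * n)) := by
    rw [Nat.card_congr e.toEquiv]
    simp
  refine ⟨hn, ?_, ?_, by decide, hV⟩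
  · have h1 := AddSubgroup.card_mul_index ((reduceModTwo n).comp e.toAddMonoidHom).ker
    rw [AddSubgroup.index_ker, AddMonoidHom.range_eq_top.2 hsurj] at h1
    rw [hG] at h1
    have h2 : Nat.card (⊤ : AddSubgroup (ZMod 2 × ZMod 2 × ZMod 2)) = 8 := by
      rw [← hV]
      exact Nat.card_congr AddSubgroup.topEquiv.toEquiv
    rw [h2] at h1
    omega
  · rw [AddMonoid.exponent_eq_of_addEquiv e, AddMonoid.exponent_prod, AddMonoid.exponent_prod,
      ZMod.exponent, ZMod.exponent]
    have : lcm 2 (2 * n) = 2 * n := (lcm_eq_right_iff 2 (2 * n) (by simp)).2 (dvd_mul_right _ _)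
    rw [this, this]

theorem exists_hasExtremalForm (hn : 2 ≤ n) (e : G ≃+ ZMod 2 × ZMod 2 × ZMod (2 * n)) :
    ∃ S : Multiset G, S.card = 2 * n + 3 ∧ HasExtremalForm n S := by
  have hR := reduction_of_equiv hn e
  refine hR.exists_hasExtremalForm (f₁ := e.symm (1, 0, 0)) (f₂ := e.symm (0, 1, 0))
    (f₃ := e.symm (0, 0, 1)) ?_ ?_ ?_ ?_
  · rw [← map_add, Prod.mk_add_mk]
    simp [CharTwo.add_self_eq_zero]
  · rw [← map_add, Prod.mk_add_mk]
    simp [CharTwo.add_self_eq_zero]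
  · have : NeZero (2 * n) := ⟨by omega⟩
    rw [← map_add, Prod.mk_add_mk]
    have h : addOrderOf (2 : ZMod (2 * n)) = n := by
      have := ZMod.addOrderOf_coe 2 (n := 2 * n) (by omega)
      rw [Nat.gcd_eq_right (dvd_mul_right 2 n)] at this
      simpa using this
    rw [AddEquiv.addOrderOf_eq]
    simp [Prod.addOrderOf_mk, one_add_one_eq_two, h]
  · constructor <;> simp [reduceModTwo]

end ZeroSum

theorem theorem4p1 {G : Type*} [AddCommGroup G] (n : ℕ) (hn : 2 ≤ n)
    (hG : Nonempty (G ≃+ ZMod 2 × ZMod 2 × ZMod (2 * n))) :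
    ZeroSum.eta G = 2 * n + 4 ∧
    ∀ S : Multiset G, S.card = 2 * n + 3 →
      (¬ ZeroSum.HasShortZeroSum S ↔
        ∃ f₁ f₂ f₃ : G, ZeroSum.IsBasis ![f₁, f₂, f₃] ∧
          addOrderOf f₁ = 2 ∧ addOrderOf f₂ = 2 ∧ addOrderOf f₃ = 2 * n ∧
          (ZeroSum.FormEta1 n f₁ f₂ f₃ S ∨ ZeroSum.FormEta2 n f₁ f₂ f₃ S ∨
            ZeroSum.FormEta3 n f₁ f₂ f₃ S)) := by
  obtain ⟨e⟩ := hG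
  have : NeZero (2 * n) := ⟨by omega⟩
  have : Finite G := Finite.of_equiv _ e.symm.toEquiv
  have hR := ZeroSum.reduction_of_equiv hn e
  -- The lower bound needs the defining set of `eta` to be nonempty, since the infimum of the empty
  -- set is `0`.
  refine ⟨le_antisymm (Nat.sInf_le ?_) (le_csInf ⟨2 * n + 4, ?_⟩ ?_), fun S hc => ⟨fun hS => ?_,
    fun h => ZeroSum.HasExtremalForm.not_hasShortZeroSum hR.exponent hn h⟩⟩
  · intro S hc
    by_contra hS
    exact (ZeroSum.card_lt_of_not_hasShortZeroSum hR hS).not_ge hc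
  · intro S hc
    by_contra hS
    exact (ZeroSum.card_lt_of_not_hasShortZeroSum hR hS).not_ge hc
  · intro l hl
    by_contra! hlt
    obtain ⟨S, hc, hS⟩ := ZeroSum.exists_hasExtremalForm hn e
    exact hS.not_hasShortZeroSum hR.exponent hn (hl S (by omega))
  · obtain ⟨x, a, b, c, d, U, h⟩ := ZeroSum.exists_shape hR hS hc
    exact h.hasExtremalForm hR
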